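/- Let $(R,\mathfrak m)$ be a complete Noetherian local ring with $\dim R=2$ which is seminormal (whenever $b,c\in R$ satisfy $b^3=c^2$ there is $a\in R$ with $a^2=b$, $a^3=c$; in particular $R$ is reduced), satisfies Serre's condition $(R_1)$ ($R_{\mathfrak p}$ is regular for every prime $\mathfrak p$ of height at most $1$), and is equidimensional ($\dim R/\mathfrak p=2$ for every minimal prime $\mathfrak p$). Then $R$ is Buchsbaum, i.e. every system of parameters $x_1,x_2$ of $R$ satisfies $\mathfrak m\,\big((x_1,\dots,x_{i-1}):x_i\big)\subseteq(x_1,\dots,x_{i-1})$ for $i=1,2$. Moreover, let $\overline R$ be the integral closure of $R$ in its total ring of fractions and $\mathfrak C=\operatorname{Ann}_R(\overline R/R)$ the conductor. Then $\mathfrak C=\operatorname{Ann}_R H^1_{\mathfrak m}(R)$, and if $R$ is not normal (i.e. $R\neq\overline R$), then $\mathfrak C=\mathfrak m=\operatorname{Ann}_R H^1_{\mathfrak m}(R)$. -/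

import Mathlib

/-- Seminormality in the sense of Swan: whenever `b ^ 3 = c ^ 2`, there is an element `a` with
`a ^ 2 = b` and `a ^ 3 = c`. Such a ring is automatically reduced, see
`IsSeminormalRing.isReduced`. -/
def IsSeminormalRing (R : Type*) [CommRing R] : Prop :=
  ∀ b c : R, b ^ 3 = c ^ 2 → ∃ a : R, a ^ 2 = b ∧ a ^ 3 = c

theorem IsSeminormalRing.isReduced {R : Type*} [CommRing R] (h : IsSeminormalRing R) :
    IsReduced R := by
  refine isReduced_iff_pow_one_lt 2 one_lt_two |>.2 fun x hx => ?_
  obtain ⟨a, ha, ha'⟩ := h 0 x (by simp [hx])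
  rw [← ha', pow_succ, ha, zero_mul]

/-- Serre's condition `(R_n)`: the localization at every prime of height at most `n` is regular. -/
def SatisfiesSerreR (R : Type*) [CommRing R] (n : ℕ) : Prop :=
  ∀ (p : Ideal R) [p.IsPrime], p.height ≤ n → IsRegularLocalRing (Localization.AtPrime p)

/-- `R` is equidimensional: `dim R/p = dim R` for every minimal prime `p`. -/
def IsEquidimensionalRing (R : Type*) [CommRing R] : Prop :=
  ∀ p ∈ minimalPrimes R, ringKrullDim (R ⧸ p) = ringKrullDim R

/-- `x_1, …, x_d` is a system of parameters of the local ring `R`: `d = dim R` and the ideal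
generated by the `x_i` is primary to the maximal ideal. -/
def IsSystemOfParameters (R : Type*) [CommRing R] [IsLocalRing R] {d : ℕ} (x : Fin d → R) : Prop :=
  ringKrullDim R = d ∧ (Ideal.span (Set.range x)).radical = IsLocalRing.maximalIdeal R

/-- A (Noetherian) local ring `(R, 𝔪)` is Buchsbaum if every system of parameters `x_1, …, x_d`
is a weak sequence: `𝔪 ((x_1, …, x_{i-1}) : x_i) ⊆ (x_1, …, x_{i-1})` for all `i`. -/
def IsBuchsbaumRing (R : Type*) [CommRing R] [IsLocalRing R] : Prop :=
  ∀ (d : ℕ) (x : Fin d → R), IsSystemOfParameters R x →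
    ∀ (i : Fin d) (a : R), a * x i ∈ Ideal.span (x '' Set.Iio i) →
      ∀ r ∈ IsLocalRing.maximalIdeal R, r * a ∈ Ideal.span (x '' Set.Iio i)

/-- The normalization `R̄`: the integral closure of `R` in its total ring of fractions. -/
abbrev Normalization (R : Type*) [CommRing R] : Subalgebra R (FractionRing R) :=
  integralClosure R (FractionRing R)

/-- The conductor ideal `Ann_R (R̄ / R)`. -/
noncomputable def conductorIdeal (R : Type*) [CommRing R] : Ideal R :=
  Module.annihilator R (Normalization R ⧸ LinearMap.range (Algebra.linearMap R (Normalization R)))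

open IsLocalRing Polynomial in
theorem Polynomial.exists_eq_distinguished_mul {D : Type*} [CommRing D] [IsLocalRing D]
    [IsAdicComplete (maximalIdeal D) D] (g : D[X]) (hg : g.map (residue D) ≠ 0) :
    ∃ G H : D[X], G.IsDistinguishedAt (maximalIdeal D) ∧ IsUnit (H.coeff 0) ∧ g = G * H := by
  obtain ⟨G, H, hGH⟩ := PowerSeries.exists_isWeierstrassFactorization (g := (g : PowerSeries D))
    (by rwa [← Polynomial.polynomial_map_coe, Ne, Polynomial.coe_eq_zero_iff])
  have hG := hGH.isDistinguishedAt
  have hdeg : (g %ₘ G).degree <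
      ((G : PowerSeries D).map (Ideal.Quotient.mk (maximalIdeal D))).order.toNat := by
    have h1 := Polynomial.degree_modByMonic_lt g hG.monic
    rwa [Polynomial.degree_eq_natDegree hG.monic.ne_zero,
      ← hG.coe_natDegree_eq_order_map (G : PowerSeries D) 1 (by simp) (by simp)] at *
  have key := (hG.isWeierstrassDivisorAt').eq_of_mul_add_eq_mul_add (q := H) (r := 0)
    (q' := (g /ₘ G : D[X])) (r' := g %ₘ G) (by simp) hdeg (by
      rw [Polynomial.coe_zero, add_zero, ← hGH.eq_mul, ← Polynomial.coe_mul, ← Polynomial.coe_add,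
        add_comm, Polynomial.modByMonic_add_div])
  refine ⟨G, g /ₘ G, hG, ?_, ?_⟩
  · have := hGH.isUnit.map (PowerSeries.constantCoeff (R := D))
    rwa [key.1, Polynomial.constantCoeff_coe] at this
  · conv_lhs => rw [← Polynomial.modByMonic_add_div g G, ← key.2, zero_add]

/-- In a Noetherian ring, a prime minimal over a principal ideal sits at the top of no chain of
three primes. -/
theorem Ideal.false_of_lt_lt_of_mem_minimalPrimes_span_singleton {S : Type*} [CommRing S]
    [IsNoetherianRing S] {P₀ P Q : Ideal S} [P₀.IsPrime] [P.IsPrime] {t : S}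
    (hQ : Q ∈ (Ideal.span {t}).minimalPrimes) (h₁ : P₀ < P) (h₂ : P < Q) : False := by
  have := hQ.isPrime
  have h := Ideal.height_le_one_of_isPrincipal_of_mem_minimalPrimes _ Q hQ
  have a := Ideal.height_add_one_le_of_lt_of_isPrime h₁
  have b := Ideal.height_add_one_le_of_lt_of_isPrime h₂
  have : (1 + 1 : ℕ∞) ≤ 1 :=
    calc (1 + 1 : ℕ∞) ≤ (P₀.height + 1) + 1 := by gcongr; exact le_add_self
      _ ≤ P.height + 1 := by gcongr
      _ ≤ 1 := b.trans h
  exact absurd this (by decide)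

theorem Ideal.exists_bot_lt_lt_of_one_lt_height {D : Type*} [CommRing D] [IsDomain D]
    {m : Ideal D} [m.IsPrime] (h : 1 < m.height) : ∃ p : Ideal D, p.IsPrime ∧ ⊥ < p ∧ p < m := by
  by_contra! hc
  refine h.not_ge ((Ideal.height_le_iff (n := 1)).2 fun q hq hlt => ?_)
  have : q = ⊥ := by
    by_contra hq'
    exact hc q hq (bot_lt_iff_ne_bot.2 hq') hlt
  simp [this]

open IsLocalRing in
/-- An integral extension of a local domain of height at least two has no element `t` whose
zero locus equals the closed fibre. -/
theorem false_of_isIntegral_of_radical {D S : Type*} [CommRing D] [IsDomain D] [IsLocalRing D]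
    [CommRing S] [IsDomain S] [IsNoetherianRing S] [Algebra D S] [FaithfulSMul D S]
    [Algebra.IsIntegral D S] (hD : 1 < (maximalIdeal D).height) {t : S} {n j : ℕ}
    (h₁ : ((maximalIdeal D) ^ n).map (algebraMap D S) ≤ Ideal.span {t})
    (h₂ : t ^ j ∈ (maximalIdeal D).map (algebraMap D S)) : False := by
  obtain ⟨p, hp, hp0, hpm⟩ := Ideal.exists_bot_lt_lt_of_one_lt_height hD
  have hbot : (⊥ : Ideal S).comap (algebraMap D S) = ⊥ :=
    (RingHom.injective_iff_ker_eq_bot _).1 (FaithfulSMul.algebraMap_injective D S)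
  obtain ⟨P, hP0, hP, hPp⟩ := Ideal.exists_ideal_over_prime_of_isIntegral p (⊥ : Ideal S)
    (by rw [hbot]; exact hp0.le)
  obtain ⟨Q, hPQ, hQ, hQm⟩ := Ideal.exists_ideal_over_prime_of_isIntegral (maximalIdeal D) P
    (by rw [hPp]; exact hpm.le)
  have hmin : Q ∈ (Ideal.span {t}).minimalPrimes := by
    refine ⟨⟨hQ, ?_⟩, fun P' ⟨hP', htP'⟩ hle => ?_⟩
    · rw [Ideal.span_singleton_le_iff_mem]
      exact hQ.mem_of_pow_mem _ (Ideal.map_le_iff_le_comap.2 hQm.ge h₂)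
    · have hm : maximalIdeal D ≤ P'.comap (algebraMap D S) := fun r hr =>
        hP'.mem_of_pow_mem n (by
          rw [← map_pow]
          exact htP' (h₁ (Ideal.mem_map_of_mem _ (Ideal.pow_mem_pow hr n))))
      have : (P'.comap (algebraMap D S)).IsMaximal := by
        rw [← (maximalIdeal.isMaximal D).eq_of_le (Ideal.IsPrime.ne_top inferInstance) hm]
        infer_instance
      exact ((Ideal.isMaximal_of_isIntegral_of_isMaximal_comap P' this).eq_of_le hQ.ne_top hle).ge
  refine Ideal.false_of_lt_lt_of_mem_minimalPrimes_span_singleton hmin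
    (lt_of_le_of_ne hP0 ?_) (lt_of_le_of_ne hPQ ?_)
  · rintro rfl
    exact hp0.ne (hbot.symm.trans hPp)
  · rintro rfl
    exact hpm.ne (hPp.symm.trans hQm)

open Polynomial in
theorem isIntegral_of_mem_adjoin_inv {D L : Type*} [CommRing D] [Field L] [Algebra D L] {x : L}
    (hx : x ≠ 0) (h : x ∈ Algebra.adjoin D {x⁻¹}) : IsIntegral D x := by
  rw [Algebra.adjoin_singleton_eq_range_aeval] at h
  obtain ⟨p, hp⟩ := h
  have hp : aeval x⁻¹ p = x := hp
  have := invertibleOfNonzero (inv_ne_zero hx)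
  have h1 := eval₂_reverse_mul_pow (algebraMap D L) x⁻¹ p
  rw [invOf_eq_inv, inv_inv, ← aeval_def, ← aeval_def, hp, inv_pow,
    mul_inv_eq_iff_eq_mul₀ (pow_ne_zero _ hx), ← pow_succ'] at h1
  refine ⟨X ^ (p.natDegree + 1) - p.reverse, monic_X_pow_sub ?_, ?_⟩
  · exact (degree_le_of_natDegree_le p.reverse_natDegree_le).trans_lt
      (WithBot.coe_lt_coe.2 (Nat.lt_succ_self _))
  · rw [← aeval_def, map_sub, h1, map_pow, aeval_X, sub_self]

open IsLocalRing Polynomial in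
/-- Over a complete Noetherian local domain of dimension at least two, a fraction that is
carried into the ring by a power of the maximal ideal is integral. -/
theorem isIntegral_of_maximalIdeal_pow_mul_mem {D L : Type*} [CommRing D] [IsDomain D]
    [IsLocalRing D] [IsNoetherianRing D] [IsAdicComplete (maximalIdeal D) D] [Field L]
    [Algebra D L] [FaithfulSMul D L] (hD : 1 < (maximalIdeal D).height) (x : L) (n : ℕ)
    (hx : ∀ r ∈ (maximalIdeal D) ^ n, ∃ s : D, algebraMap D L r * x = algebraMap D L s) :
    IsIntegral D x := by
  by_contra hint
  have hx0 : x ≠ 0 := by rintro rfl; exact hint isIntegral_zero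
  let S := Algebra.adjoin D {x⁻¹}
  let t : S := ⟨x⁻¹, Algebra.self_mem_adjoin_singleton D _⟩
  have hinj := FaithfulSMul.algebraMap_injective D L
  have : FaithfulSMul D S := (faithfulSMul_iff_algebraMap_injective D S).2 fun a b h =>
    hinj (congrArg (Subtype.val : S → L) h)
  have : IsNoetherianRing S := by
    have : Algebra.FiniteType D S := (Subalgebra.fg_iff_finiteType _).1
      (Subalgebra.fg_adjoin_finset {x⁻¹} |> fun h => by simpa [S] using h)
    exact Algebra.FiniteType.isNoetherianRing D S
  have hsurj : Function.Surjective (aeval (R := D) t) := by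
    rintro ⟨y, hy⟩
    obtain ⟨p, rfl⟩ : y ∈ (aeval (R := D) x⁻¹).range := by
      rwa [← Algebra.adjoin_singleton_eq_range_aeval]
    refine ⟨p, Subtype.ext ?_⟩
    rw [← Subalgebra.coe_val, ← Polynomial.aeval_algHom_apply]
    rfl
  have ht : ¬ IsUnit t := by
    intro hu
    obtain ⟨⟨y, hy⟩, hty⟩ := hu.exists_right_inv
    have : x⁻¹ * y = 1 := congrArg Subtype.val hty
    have hyx : y = x := by field_simp at this; exact this
    subst hyx
    exact hint (isIntegral_of_mem_adjoin_inv hx0 hy)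
  have hmt : ((maximalIdeal D) ^ n).map (algebraMap D S) ≤ Ideal.span {t} := by
    rw [Ideal.map_le_iff_le_comap]
    intro r hr
    obtain ⟨s, hs⟩ := hx r hr
    rw [Ideal.mem_comap, Ideal.mem_span_singleton]
    refine ⟨algebraMap D S s, Subtype.ext ?_⟩
    change algebraMap D L r = x⁻¹ * algebraMap D L s
    rw [← hs]
    field_simp
  by_cases hcase : ∀ p : D[X], aeval t p ∈ (maximalIdeal D).map (algebraMap D S) →
      p ∈ (maximalIdeal D).map (C : D →+* D[X])
  · obtain ⟨Q, hQ⟩ : ((Ideal.span {t}).minimalPrimes).Nonempty :=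
      Set.nonempty_coe_sort.1 <| Ideal.nonempty_minimalPrimes (by rwa [Ne, Ideal.span_singleton_eq_top])
    have hQp := hQ.isPrime
    have hcomap : ((maximalIdeal D).map (algebraMap D S)).comap (aeval (R := D) t) =
        (maximalIdeal D).map (C : D →+* D[X]) := by
      refine le_antisymm (fun p hp => hcase p hp) ?_
      rw [Ideal.map_le_iff_le_comap]
      intro r hr
      simpa using Ideal.mem_map_of_mem (algebraMap D S) hr
    have hP : ((maximalIdeal D).map (algebraMap D S)).IsPrime := by
      rw [← Ideal.map_comap_of_surjective _ hsurj (Ideal.map _ _), hcomap]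
      apply Ideal.map_isPrime_of_surjective hsurj
      rw [← hcomap]
      exact Ideal.comap_mono bot_le
    obtain ⟨q, hq, hq0, hqm⟩ := Ideal.exists_bot_lt_lt_of_one_lt_height hD
    refine Ideal.false_of_lt_lt_of_mem_minimalPrimes_span_singleton hQ
      (P₀ := ⊥) (P := (maximalIdeal D).map (algebraMap D S)) ?_ ?_
    · rw [bot_lt_iff_ne_bot, Ne, Ideal.map_eq_bot_iff_of_injective
        (FaithfulSMul.algebraMap_injective D S)]
      exact (hq0.trans hqm).ne'
    · refine lt_of_le_of_ne ?_ ?_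
      · rw [Ideal.map_le_iff_le_comap]
        intro r hr
        refine hQp.mem_of_pow_mem n ?_
        rw [← map_pow]
        exact hQ.1.2 (hmt (Ideal.mem_map_of_mem _ (Ideal.pow_mem_pow hr n)))
      · intro heq
        have htQ : t ∈ Q := hQ.1.2 (Ideal.mem_span_singleton_self t)
        have hX := hcase X (by rw [aeval_X, heq]; exact htQ)
        have := (Ideal.mem_map_C_iff.1 hX) 1
        rw [coeff_X_one] at this
        exact (Ideal.ne_top_iff_one _).1 (Ideal.IsPrime.ne_top inferInstance) this
  · push Not at hcase
    obtain ⟨p, hp, hpm⟩ := hcase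
    obtain ⟨q, hq, hqp⟩ : ∃ q ∈ (maximalIdeal D).map (C : D →+* D[X]), aeval t q = aeval t p := by
      have : (maximalIdeal D).map (algebraMap D S) =
          ((maximalIdeal D).map (C : D →+* D[X])).map (aeval (R := D) t : D[X] →+* S) := by
        rw [Ideal.map_map]
        congr 1
        ext r
        simp
      rw [this] at hp
      exact (Ideal.mem_map_iff_of_surjective _ hsurj).1 hp
    have hg : (p - q).map (residue D) ≠ 0 := by
      intro h0
      apply hpm
      rw [← sub_add_cancel p q]
      refine Ideal.add_mem _ (Ideal.mem_map_C_iff.2 fun k => ?_) hq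
      have := congrArg (fun f => coeff f k) h0
      rwa [coeff_map, coeff_zero, residue_eq_zero_iff] at this
    obtain ⟨G, H, hG, hH, hGH⟩ := Polynomial.exists_eq_distinguished_mul _ hg
    have hroot : aeval t G * aeval t H = 0 := by
      rw [← map_mul, ← hGH, map_sub, hqp, sub_self]
    rcases mul_eq_zero.1 hroot with h0 | h0
    · have hS : Algebra.IsIntegral D S := by
        have : IsIntegral D x⁻¹ := ⟨G, hG.monic, by
          have := congrArg Subtype.val h0
          rwa [← Subalgebra.coe_val, ← Polynomial.aeval_algHom_apply] at this⟩
        exact Algebra.IsIntegral.adjoin (by simpa using this)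
      refine false_of_isIntegral_of_radical hD (j := G.natDegree) hmt ?_
      rw [aeval_eq_sum_range, Finset.sum_range_succ, hG.monic.coeff_natDegree, one_smul,
        add_comm] at h0
      rw [eq_neg_of_add_eq_zero_left h0]
      refine neg_mem (Ideal.sum_mem _ fun i hi => ?_)
      rw [Algebra.smul_def]
      exact Ideal.mul_mem_right _ _ (Ideal.mem_map_of_mem _ (hG.mem (Finset.mem_range.1 hi)))
    · apply ht
      rw [← Polynomial.divX_mul_X_add H, map_add, map_mul, aeval_X, aeval_C] at h0
      have hu := (hH.map (algebraMap D S)).neg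
      rw [← eq_neg_iff_add_eq_zero] at h0
      rw [← h0] at hu
      exact isUnit_of_mul_isUnit_right hu

open IsLocalRing nonZeroDivisors

theorem IsLocalRing.map_mk_maximalIdeal {R : Type*} [CommRing R] [IsLocalRing R] (I : Ideal R)
    [IsLocalRing (R ⧸ I)] :
    (maximalIdeal R).map (Ideal.Quotient.mk I) = maximalIdeal (R ⧸ I) := by
  refine le_antisymm ?_ fun y hy => ?_
  · exact ((local_hom_TFAE (Ideal.Quotient.mk I)).out 0 2).1
      (IsLocalHom.of_surjective _ Ideal.Quotient.mk_surjective)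
  · obtain ⟨y, rfl⟩ := Ideal.Quotient.mk_surjective y
    exact Ideal.mem_map_of_mem _ fun hu => hy (hu.map _)

theorem IsAdicComplete.quotient_maximalIdeal {R : Type*} [CommRing R] [IsLocalRing R]
    [IsNoetherianRing R] [IsAdicComplete (maximalIdeal R) R] (I : Ideal R)
    [IsLocalRing (R ⧸ I)] : IsAdicComplete (maximalIdeal (R ⧸ I)) (R ⧸ I) where
  haus' := (IsHausdorff.of_isLocalRing (maximalIdeal (R ⧸ I)) (R ⧸ I)
    (Ideal.IsPrime.ne_top inferInstance)).haus'
  prec' f hf := by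
    have hmap (n : ℕ) : ((maximalIdeal R) ^ n).map (Ideal.Quotient.mk I) =
        (maximalIdeal (R ⧸ I)) ^ n := by
      rw [Ideal.map_pow, IsLocalRing.map_mk_maximalIdeal]
    have step (n : ℕ) : ∃ d ∈ (maximalIdeal R) ^ n, Ideal.Quotient.mk I d = f (n + 1) - f n := by
      have := (hf (Nat.le_succ n)).symm
      rw [SModEq.sub_mem, smul_eq_mul, Ideal.mul_top, ← hmap,
        Ideal.mem_map_iff_of_surjective _ Ideal.Quotient.mk_surjective] at this
      exact this
    choose d hd hdf using step
    obtain ⟨a, ha⟩ := Ideal.Quotient.mk_surjective (f 0)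
    let g : ℕ → R := fun n => a + ∑ i ∈ Finset.range n, d i
    have hg (n : ℕ) : Ideal.Quotient.mk I (g n) = f n := by
      simp only [g, map_add, map_sum, hdf, ha, Finset.sum_range_sub]
      ring
    have hcauchy {m n : ℕ} (h : m ≤ n) :
        g m ≡ g n [SMOD ((maximalIdeal R) ^ m • ⊤ : Submodule R R)] := by
      symm
      rw [SModEq.sub_mem, smul_eq_mul, Ideal.mul_top, add_sub_add_left_eq_sub,
        ← Finset.sum_Ico_eq_sub _ h]
      exact Ideal.sum_mem _ fun i hi => Ideal.pow_le_pow_right (Finset.mem_Ico.1 hi).1 (hd i)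
    obtain ⟨L, hL⟩ := IsPrecomplete.prec (I := maximalIdeal R) inferInstance hcauchy
    refine ⟨Ideal.Quotient.mk I L, fun n => ?_⟩
    have := hL n
    rw [SModEq.sub_mem, smul_eq_mul, Ideal.mul_top] at this ⊢
    rw [← hg, ← map_sub, ← hmap]
    exact Ideal.mem_map_of_mem _ this

/-- The fractions carried into `R` by a power of `I`, i.e. the `I`-torsion of `K / R`. -/
def IsCarriedByPow {R : Type*} [CommRing R] (I : Ideal R) {K : Type*} [CommRing K] [Algebra R K]
    (x : K) : Prop :=
  ∃ n : ℕ, ∀ r ∈ I ^ n, ∃ s : R, algebraMap R K r * x = algebraMap R K s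

section Components

variable {R : Type*} [CommRing R]

theorem notMem_of_mem_minimalPrimes_of_mem_nonZeroDivisors {p : Ideal R}
    (hp : p ∈ minimalPrimes R) {s : R} (hs : s ∈ R⁰) : s ∉ p := fun hsp =>
  Set.disjoint_left.1 (Ideal.disjoint_nonZeroDivisors_of_mem_minimalPrimes hp) hsp hs

theorem mem_nonZeroDivisors_of_forall_notMem_minimalPrimes [IsReduced R] {s : R}
    (h : ∀ p ∈ minimalPrimes R, s ∉ p) : s ∈ R⁰ := by
  rw [mem_nonZeroDivisors_iff_right]
  intro a ha
  have : a ∈ nilradical R := by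
    rw [nilradical, ← Ideal.sInf_minimalPrimes]
    refine (Submodule.mem_sInf).2 fun p hp => ?_
    exact ((Ideal.IsMinimalPrime.isPrime hp).mem_or_mem (ha ▸ p.zero_mem : a * s ∈ p)).resolve_right
      (h p hp)
  rwa [nilradical_eq_zero] at this

/-- An element of the total ring of fractions of a reduced Noetherian ring is integral as soon as
it is integral on each component. -/
theorem isIntegral_of_forall_minimalPrimes [IsNoetherianRing R] [IsReduced R] (x : FractionRing R)
    (h : ∀ p ∈ minimalPrimes R, ∀ (φ : FractionRing R →+* FractionRing (R ⧸ p)),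
      (∀ r, φ (algebraMap R _ r) = algebraMap _ _ (Ideal.Quotient.mk p r)) →
      IsIntegral (R ⧸ p) (φ x)) : IsIntegral R x := by
  have key (p : Ideal R) (hp : p ∈ minimalPrimes R) : ∃ f : Polynomial R, f.Monic ∧
      ∃ a ∈ p, ∃ s ∈ R⁰, Polynomial.aeval x f * algebraMap R _ s = algebraMap R _ a := by
    have hpp := Ideal.IsMinimalPrime.isPrime hp
    let ψ : R →+* FractionRing (R ⧸ p) := (algebraMap _ _).comp (Ideal.Quotient.mk p)
    have hψ (r : R) : ψ r = 0 ↔ r ∈ p := by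
      rw [← Ideal.Quotient.eq_zero_iff_mem]
      exact map_eq_zero_iff _ (IsFractionRing.injective (R ⧸ p) (FractionRing (R ⧸ p)))
    have hunit (s : R⁰) : IsUnit (ψ s) := by
      rw [isUnit_iff_ne_zero, Ne, hψ]
      exact notMem_of_mem_minimalPrimes_of_mem_nonZeroDivisors hp s.2
    let φ : FractionRing R →+* FractionRing (R ⧸ p) := IsLocalization.lift hunit
    have hφ (r : R) : φ (algebraMap R _ r) = ψ r := IsLocalization.lift_eq hunit r
    obtain ⟨g, hg, hgx⟩ := h p hp φ hφ
    obtain ⟨f, hfg, -, hf⟩ := Polynomial.lifts_and_degree_eq_and_monic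
      (Polynomial.map_surjective _ Ideal.Quotient.mk_surjective g) hg
    obtain ⟨⟨a, s⟩, has⟩ := IsLocalization.surj R⁰ (Polynomial.aeval x f)
    refine ⟨f, hf, a, ?_, s, s.2, has⟩
    rw [← hψ, ← hφ, ← has, map_mul]
    have : φ (Polynomial.aeval x f) = 0 := by
      rw [Polynomial.aeval_def, Polynomial.hom_eval₂, ← hgx, ← hfg, Polynomial.eval₂_map]
      congr 1
      ext r
      exact hφ r
    rw [this, zero_mul]
  choose f hf a ha s hs has using key
  have hfin := minimalPrimes.finite_of_isNoetherianRing R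
  let T := hfin.toFinset.attach
  have hT (p : {p // p ∈ hfin.toFinset}) : p.1 ∈ minimalPrimes R := hfin.mem_toFinset.1 p.2
  refine ⟨∏ p ∈ T, f p.1 (hT p), Polynomial.monic_prod_of_monic _ _ fun p _ => hf _ _, ?_⟩
  have hprod : (∏ p ∈ T, a p.1 (hT p)) = 0 := by
    have : (∏ p ∈ T, a p.1 (hT p)) ∈ nilradical R := by
      rw [nilradical, ← Ideal.sInf_minimalPrimes]
      refine Submodule.mem_sInf.2 fun p hp => ?_
      exact Ideal.mem_of_dvd _ (Finset.dvd_prod_of_mem (fun p => a p.1 (hT p))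
        (Finset.mem_attach _ ⟨p, hfin.mem_toFinset.2 hp⟩)) (ha p hp)
    rwa [nilradical_eq_zero] at this
  have hsprod : IsUnit (algebraMap R (FractionRing R) (∏ p ∈ T, s p.1 (hT p))) :=
    IsLocalization.map_units _ (⟨_, prod_mem fun p _ => hs p.1 (hT p)⟩ : R⁰)
  rw [← hsprod.mul_left_eq_zero, ← Polynomial.aeval_def, map_prod, map_prod,
    ← Finset.prod_mul_distrib, Finset.prod_congr rfl fun p _ => has p.1 (hT p), ← map_prod,
    hprod, map_zero]

end Components

section DimTwo

variable {R : Type*} [CommRing R] [IsLocalRing R] [IsNoetherianRing R]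

theorem isIntegral_of_isCarriedByPow [IsReduced R] [IsAdicComplete (maximalIdeal R) R]
    (hdim : ringKrullDim R = 2) (hequi : IsEquidimensionalRing R) {x : FractionRing R}
    (hx : IsCarriedByPow (maximalIdeal R) x) : IsIntegral R x := by
  obtain ⟨n, hx⟩ := hx
  refine isIntegral_of_forall_minimalPrimes x fun p hp φ hφ => ?_
  have hpp := Ideal.IsMinimalPrime.isPrime hp
  have : IsLocalRing (R ⧸ p) := .of_surjective' _ Ideal.Quotient.mk_surjective
  have := IsAdicComplete.quotient_maximalIdeal p
  refine isIntegral_of_maximalIdeal_pow_mul_mem ?_ _ n fun r hr => ?_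
  · have h := (maximalIdeal_height_eq_ringKrullDim (R := R ⧸ p)).trans ((hequi p hp).trans hdim)
    have h' : (maximalIdeal (R ⧸ p)).height = 2 := WithBot.coe_injective h
    rw [h']
    decide
  · rw [← IsLocalRing.map_mk_maximalIdeal, ← Ideal.map_pow,
      Ideal.mem_map_iff_of_surjective _ Ideal.Quotient.mk_surjective] at hr
    obtain ⟨r, hr, rfl⟩ := hr
    obtain ⟨s, hs⟩ := hx r hr
    exact ⟨Ideal.Quotient.mk p s, by rw [← hφ, ← map_mul, hs, hφ]⟩

theorem exists_mem_maximalIdeal_mem_nonZeroDivisors [IsReduced R]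
    (hdim : ringKrullDim R = 2) (hequi : IsEquidimensionalRing R) :
    ∃ s ∈ maximalIdeal R, s ∈ R⁰ := by
  by_contra! hc
  have hfin := minimalPrimes.finite_of_isNoetherianRing R
  have hsub : (maximalIdeal R : Set R) ⊆ ⋃ p ∈ (hfin.toFinset : Set (Ideal R)), (p : Set R) := by
    intro s hs
    by_contra hs'
    refine hc s hs (mem_nonZeroDivisors_of_forall_notMem_minimalPrimes fun p hp hsp => hs' ?_)
    simp only [Set.mem_iUnion]
    exact ⟨p, by simpa using hp, hsp⟩
  obtain ⟨p, hp, hle⟩ := (Ideal.subset_union_prime ⊥ ⊥ fun p hp _ _ =>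
    Ideal.IsMinimalPrime.isPrime (by simpa using hp)).1 hsub
  have hp : p ∈ minimalPrimes R := by simpa using hp
  have hpp := Ideal.IsMinimalPrime.isPrime hp
  have hpm : p.IsMaximal := by
    rw [← (maximalIdeal.isMaximal R).eq_of_le hpp.ne_top hle]
    infer_instance
  have := (hequi p hp).trans hdim
  rw [ringKrullDim_eq_zero_of_isField ((Ideal.Quotient.maximal_ideal_iff_isField_quotient p).1 hpm)]
    at this
  exact absurd this (by decide)

theorem IsSystemOfParameters.mem_nonZeroDivisors [IsReduced R]
    (hequi : IsEquidimensionalRing R) {x : Fin 2 → R} (hx : IsSystemOfParameters R x) (i : Fin 2) :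
    x i ∈ R⁰ := by
  obtain ⟨hdim, hrad⟩ := hx
  refine mem_nonZeroDivisors_of_forall_notMem_minimalPrimes fun p hp hxp => ?_
  have hpp := Ideal.IsMinimalPrime.isPrime hp
  have : IsLocalRing (R ⧸ p) := .of_surjective' _ Ideal.Quotient.mk_surjective
  let y := Ideal.Quotient.mk p (x (1 - i))
  have hxm (j : Fin 2) : x j ∈ maximalIdeal R :=
    hrad ▸ Ideal.le_radical (Ideal.subset_span ⟨j, rfl⟩)
  have hmin : maximalIdeal (R ⧸ p) ∈ (Ideal.span {y}).minimalPrimes := by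
    refine ⟨⟨inferInstance, ?_⟩, fun Q ⟨hQ, hyQ⟩ _ => ?_⟩
    · rw [Ideal.span_singleton_le_iff_mem, ← IsLocalRing.map_mk_maximalIdeal]
      exact Ideal.mem_map_of_mem _ (hxm _)
    · rw [← IsLocalRing.map_mk_maximalIdeal, Ideal.map_le_iff_le_comap, ← hrad,
        (hQ.comap _).radical_le_iff, Ideal.span_le]
      rintro _ ⟨j, rfl⟩
      by_cases hj : j = i
      · subst hj
        change Ideal.Quotient.mk p (x j) ∈ Q
        rw [Ideal.Quotient.eq_zero_iff_mem.2 hxp]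
        exact Q.zero_mem
      · have : j = 1 - i := by omega
        subst this
        exact hyQ (Ideal.mem_span_singleton_self _)
  have h := (maximalIdeal_height_eq_ringKrullDim (R := R ⧸ p)).trans ((hequi p hp).trans hdim)
  have h' : (maximalIdeal (R ⧸ p)).height = 2 := WithBot.coe_injective h
  have h1 := Ideal.height_le_one_of_isPrincipal_of_mem_minimalPrimes _ _ hmin
  rw [h'] at h1
  exact absurd h1 (by decide)

end DimTwo

theorem IsLocalRing.exists_eq_unit_mul_pow {A : Type*} [CommRing A] [IsLocalRing A]
    [IsNoetherianRing A] {ϖ : A} (hϖ : maximalIdeal A = Ideal.span {ϖ}) {a : A} (ha : a ≠ 0) :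
    ∃ (k : ℕ) (u : A), IsUnit u ∧ a = u * ϖ ^ k := by
  have hex : ∃ k : ℕ, a ∉ maximalIdeal A ^ k := by
    by_contra! h
    have := Ideal.iInf_pow_eq_bot_of_isLocalRing (maximalIdeal A)
      (Ideal.IsPrime.ne_top inferInstance)
    exact ha ((Submodule.mem_bot A).1 (this ▸ (Submodule.mem_iInf _).2 h))
  classical
  have hpos : Nat.find hex ≠ 0 := fun h => by
    have := Nat.find_spec hex
    simp [h] at this
  obtain ⟨k, hk⟩ := Nat.exists_eq_succ_of_ne_zero hpos
  have h1 : a ∈ maximalIdeal A ^ k := not_not.1 (Nat.find_min hex (by omega))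
  have h2 : a ∉ maximalIdeal A ^ (k + 1) := by
    have := Nat.find_spec hex
    rwa [hk] at this
  rw [hϖ, Ideal.span_singleton_pow, Ideal.mem_span_singleton] at h1 h2
  obtain ⟨u, rfl⟩ := h1
  refine ⟨k, u, ?_, mul_comm _ _⟩
  by_contra hu
  have : u ∈ maximalIdeal A := hu
  rw [hϖ, Ideal.mem_span_singleton] at this
  exact h2 (pow_succ ϖ k ▸ mul_dvd_mul_left _ this)

theorem IsRegularLocalRing.exists_maximalIdeal_eq_span_singleton {A : Type*} [CommRing A]
    [IsRegularLocalRing A] (h : ringKrullDim A ≤ 1) :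
    ∃ ϖ : A, maximalIdeal A = Ideal.span {ϖ} := by
  have h1 : (maximalIdeal A).spanFinrank ≤ 1 := by
    rw [← IsRegularLocalRing.spanFinrank_maximalIdeal] at h
    exact_mod_cast h
  have hfg : (maximalIdeal A).FG := IsNoetherian.noetherian _
  have hcard := Submodule.FG.generators_ncard hfg
  have hspan := Submodule.span_generators (maximalIdeal A)
  rw [← hcard, Set.ncard_le_one (Submodule.FG.finite_generators hfg)] at h1
  rcases Set.Subsingleton.eq_empty_or_singleton (fun a ha b hb => h1 a ha b hb) with h | ⟨ϖ, h⟩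
  · exact ⟨0, by rw [← hspan, h]; simp⟩
  · exact ⟨ϖ, by rw [← hspan, h]⟩

theorem IsRegularLocalRing.isDomain_and_isIntegrallyClosed {A : Type*} [CommRing A] [IsReduced A]
    [IsRegularLocalRing A] (h : ringKrullDim A ≤ 1) : IsDomain A ∧ IsIntegrallyClosed A := by
  obtain ⟨ϖ, hϖ⟩ := IsRegularLocalRing.exists_maximalIdeal_eq_span_singleton h
  have hdom : IsDomain A := by
    refine @NoZeroDivisors.to_isDomain A _ _ ⟨fun {a b} hab => ?_⟩
    by_contra! hne
    obtain ⟨k, u, hu, rfl⟩ := exists_eq_unit_mul_pow hϖ hne.1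
    obtain ⟨l, v, hv, rfl⟩ := exists_eq_unit_mul_pow hϖ hne.2
    rw [mul_mul_mul_comm, (hu.mul hv).mul_right_eq_zero, ← pow_add] at hab
    obtain rfl : ϖ = 0 := eq_zero_of_pow_eq_zero hab
    rcases k with _ | k
    · rcases l with _ | l
      · simp at hab
      · exact hne.2 (by simp)
    · exact hne.1 (by simp)
  refine ⟨hdom, ?_⟩
  have hprin : (maximalIdeal A).IsPrincipal := ⟨⟨ϖ, hϖ⟩⟩
  have h43 := (tfae_of_isNoetherianRing_of_isLocalRing_of_isDomain A).out 4 3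
  exact (h43.1 hprin).1

theorem IsIntegral.exists_notMem_mul_eq_algebraMap {R : Type*} [CommRing R]
    {x : FractionRing R} (hx : IsIntegral R x) (p : Ideal R) [p.IsPrime]
    [IsDomain (Localization.AtPrime p)] [IsIntegrallyClosed (Localization.AtPrime p)] :
    ∃ s ∉ p, ∃ c : R, algebraMap R _ s * x = algebraMap R _ c := by
  let F := FractionRing (Localization.AtPrime p)
  let ψ : R →+* F := (algebraMap (Localization.AtPrime p) F).comp (algebraMap R _)
  have hF : Function.Injective (algebraMap (Localization.AtPrime p) F) := IsFractionRing.injective _ _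
  have hunit (b : R⁰) : IsUnit (ψ b) := by
    rw [isUnit_iff_ne_zero]
    intro h0
    have h1 : algebraMap R (Localization.AtPrime p) b = 0 := by
      apply hF
      rw [map_zero]
      exact h0
    obtain ⟨⟨t, ht⟩, h2⟩ := (IsLocalization.map_eq_zero_iff p.primeCompl _ _).1 h1
    have : t = 0 := (mul_right_mem_nonZeroDivisors_eq_zero_iff b.2).1 h2
    exact ht (this ▸ p.zero_mem)
  let φ : FractionRing R →+* F := IsLocalization.lift hunit
  have hφ (r : R) : φ (algebraMap R _ r) = ψ r := IsLocalization.lift_eq hunit r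
  have hint : IsIntegral (Localization.AtPrime p) (φ x) := by
    refine hx.map_of_comp_eq (algebraMap R (Localization.AtPrime p)) φ ?_
    ext r
    exact (hφ r).symm
  obtain ⟨α, hα⟩ := IsIntegrallyClosed.isIntegral_iff.1 hint
  obtain ⟨⟨c, s⟩, hcs⟩ := IsLocalization.surj p.primeCompl α
  obtain ⟨⟨a, b⟩, hab⟩ := IsLocalization.surj R⁰ x
  have h1 : algebraMap R (Localization.AtPrime p) (a * s) = algebraMap R _ (c * b) := by
    apply hF
    have e1 : φ x * ψ b = ψ a := by rw [← hφ, ← map_mul, hab, hφ]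
    have e2 : φ x * ψ s = ψ c := by
      rw [← hα]
      exact (map_mul _ _ _).symm.trans (congrArg _ hcs)
    change ψ (a * s) = ψ (c * b)
    rw [map_mul, map_mul, ← e1, ← e2]
    ring
  obtain ⟨t, ht⟩ := (IsLocalization.eq_iff_exists p.primeCompl _).1 h1
  refine ⟨t * s, (t * s).2, t * c, ?_⟩
  have hb : IsUnit (algebraMap R (FractionRing R) b) := IsLocalization.map_units _ b
  rw [← hb.mul_left_inj, mul_assoc, hab, ← map_mul, ← map_mul]
  congr 1
  simp only
  linear_combination ht

section

variable {R : Type*} [CommRing R] [IsLocalRing R] [IsNoetherianRing R]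

theorem IsIntegral.isCarriedByPow [IsReduced R] (hdim : ringKrullDim R = 2)
    (hR1 : SatisfiesSerreR R 1) {x : FractionRing R} (hx : IsIntegral R x) :
    IsCarriedByPow (maximalIdeal R) x := by
  let J : Ideal R := (LinearMap.range (Algebra.linearMap R (FractionRing R))).comap
    (LinearMap.toSpanSingleton R _ x)
  have hJ {r : R} : r ∈ J ↔ ∃ s, algebraMap R (FractionRing R) r * x = algebraMap R _ s := by
    simp [J, Algebra.smul_def, eq_comm]
  have hrad : maximalIdeal R ≤ J.radical := by
    rw [Ideal.radical_eq_sInf]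
    refine le_sInf fun p ⟨hJp, hp⟩ => ?_
    by_contra hne
    have hlt : p < maximalIdeal R := lt_of_le_not_ge (le_maximalIdeal hp.ne_top) hne
    have hht : p.height ≤ 1 := by
      have h1 := Ideal.height_add_one_le_of_lt_of_isPrime hlt
      have h2 : (maximalIdeal R).height = 2 :=
        WithBot.coe_injective ((maximalIdeal_height_eq_ringKrullDim (R := R)).trans hdim)
      rw [h2, ← one_add_one_eq_two] at h1
      exact (ENat.add_le_add_iff_right ENat.one_ne_top).1 h1
    have := hR1 p hht
    obtain ⟨_, _⟩ := IsRegularLocalRing.isDomain_and_isIntegrallyClosed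
      (A := Localization.AtPrime p) (by
        rw [IsLocalization.AtPrime.ringKrullDim_eq_height p]
        exact_mod_cast hht)
    obtain ⟨s, hs, hsx⟩ := hx.exists_notMem_mul_eq_algebraMap p
    exact hs (hJp (hJ.2 hsx))
  obtain ⟨n, hn⟩ := Ideal.exists_pow_le_of_le_radical_of_fg hrad (IsNoetherian.noetherian _)
  exact ⟨n, fun r hr => hJ.1 (hn hr)⟩

theorem exists_forall_pow_of_fg {R : Type*} [CommRing R] {I : Ideal R} {K : Type*} [CommRing K]
    [Algebra R K] {M : Submodule R K} (hM : M.FG) (h : ∀ y ∈ M, IsCarriedByPow I y) :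
    ∃ n : ℕ, ∀ y ∈ M, ∀ r ∈ I ^ n, ∃ s : R, algebraMap R K r * y = algebraMap R K s := by
  classical
  obtain ⟨T, rfl⟩ := hM
  choose! n hn using h
  refine ⟨T.sup n, fun y hy r hr => ?_⟩
  induction hy using Submodule.span_induction with
  | mem y hy =>
    exact hn y (Submodule.subset_span hy) r (Ideal.pow_le_pow_right (Finset.le_sup hy) hr)
  | zero => exact ⟨0, by simp⟩
  | add y z _ _ hy hz =>
    obtain ⟨s, hs⟩ := hy
    obtain ⟨t, ht⟩ := hz
    exact ⟨s + t, by rw [mul_add, hs, ht, map_add]⟩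
  | smul a y _ hy =>
    obtain ⟨s, hs⟩ := hy
    exact ⟨a * s, by rw [Algebra.smul_def, mul_left_comm, hs, map_mul]⟩

theorem IsSeminormalRing.mem_range_of_pow {R : Type*} [CommRing R] (hsn : IsSeminormalRing R)
    {y : FractionRing R} (h2 : y ^ 2 ∈ (algebraMap R (FractionRing R)).range)
    (h3 : y ^ 3 ∈ (algebraMap R (FractionRing R)).range) :
    y ∈ (algebraMap R (FractionRing R)).range := by
  obtain ⟨b, hb⟩ := h2
  obtain ⟨c, hc⟩ := h3
  have := hsn.isReduced
  obtain ⟨a, ha2, ha3⟩ := hsn b c (IsFractionRing.injective R (FractionRing R) (by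
    rw [map_pow, map_pow, hb, hc]
    ring))
  refine ⟨a, sub_eq_zero.1 (eq_zero_of_pow_eq_zero (n := 3) ?_)⟩
  rw [← ha2, map_pow] at hb
  rw [← ha3, map_pow] at hc
  linear_combination (-3 * y - 3 * algebraMap R _ a) * hb + 4 * hc

theorem IsSeminormalRing.mem_range_of_forall_pow {R : Type*} [CommRing R]
    (hsn : IsSeminormalRing R) {y : FractionRing R} (N : ℕ)
    (h : ∀ n ≥ N, y ^ n ∈ (algebraMap R (FractionRing R)).range) :
    y ∈ (algebraMap R (FractionRing R)).range := by
  induction N with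
  | zero => simpa using h 1 (Nat.zero_le _)
  | succ N ih =>
    rcases N.eq_zero_or_pos with rfl | hN
    · simpa using h 1 le_rfl
    · refine ih fun n hn => hsn.mem_range_of_pow ?_ ?_
      · rw [← pow_mul]
        exact h _ (by omega)
      · rw [← pow_mul]
        exact h _ (by omega)

/-- In the seminormal case the maximal ideal multiplies the normalization into the ring. -/
theorem IsSeminormalRing.mul_mem_range_of_isIntegral (hsn : IsSeminormalRing R)
    (hdim : ringKrullDim R = 2) (hR1 : SatisfiesSerreR R 1) {x : FractionRing R}
    (hx : IsIntegral R x) {r : R} (hr : r ∈ maximalIdeal R) :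
    algebraMap R _ r * x ∈ (algebraMap R (FractionRing R)).range := by
  have := hsn.isReduced
  have hfg : (Subalgebra.toSubmodule (Algebra.adjoin R {x})).FG := hx.fg_adjoin_singleton
  obtain ⟨N, hN⟩ := exists_forall_pow_of_fg (I := maximalIdeal R) hfg fun y hy =>
    IsIntegral.isCarriedByPow hdim hR1
      (Algebra.adjoin_le (S := integralClosure R _) (Set.singleton_subset_iff.2 hx) hy)
  refine hsn.mem_range_of_forall_pow N fun n hn => ?_
  obtain ⟨s, hs⟩ := hN (x ^ n) (pow_mem (Algebra.self_mem_adjoin_singleton R x) n) (r ^ n)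
    (Ideal.pow_le_pow_right hn (Ideal.pow_mem_pow hr n))
  exact ⟨s, by rw [mul_pow, ← map_pow, hs]⟩

theorem mem_conductorIdeal_iff {R : Type*} [CommRing R] {r : R} :
    r ∈ conductorIdeal R ↔ ∀ x : FractionRing R, IsIntegral R x →
      algebraMap R _ r * x ∈ (algebraMap R (FractionRing R)).range := by
  rw [conductorIdeal, Module.mem_annihilator]
  constructor
  · intro h x hx
    have := h (Submodule.Quotient.mk (⟨x, hx⟩ : Normalization R))
    rw [← Submodule.Quotient.mk_smul, Submodule.Quotient.mk_eq_zero] at this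
    obtain ⟨s, hs⟩ := this
    exact ⟨s, (congrArg Subtype.val hs).trans (Algebra.smul_def _ _)⟩
  · intro h y
    obtain ⟨⟨x, hx⟩, rfl⟩ := Submodule.Quotient.mk_surjective _ y
    obtain ⟨s, hs⟩ := h x hx
    rw [← Submodule.Quotient.mk_smul, Submodule.Quotient.mk_eq_zero]
    exact ⟨s, Subtype.ext (hs.trans (Algebra.smul_def _ _).symm)⟩

theorem IsSeminormalRing.conductorIdeal_eq_maximalIdeal (hsn : IsSeminormalRing R)
    (hdim : ringKrullDim R = 2) (hR1 : SatisfiesSerreR R 1)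
    (hR : ¬ IsIntegrallyClosedIn R (FractionRing R)) : conductorIdeal R = maximalIdeal R := by
  refine (le_maximalIdeal fun htop => hR ?_).antisymm fun r hr =>
    mem_conductorIdeal_iff.2 fun x hx => hsn.mul_mem_range_of_isIntegral hdim hR1 hx hr
  rw [isIntegrallyClosedIn_iff]
  refine ⟨IsFractionRing.injective _ _, fun {x} hx => ?_⟩
  have := mem_conductorIdeal_iff.1 (htop ▸ Submodule.mem_top : (1 : R) ∈ conductorIdeal R) x hx
  rwa [map_one, one_mul] at this

theorem IsSeminormalRing.isBuchsbaumRing [IsAdicComplete (maximalIdeal R) R]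
    (hsn : IsSeminormalRing R) (hdim : ringKrullDim R = 2) (hequi : IsEquidimensionalRing R)
    (hR1 : SatisfiesSerreR R 1) : IsBuchsbaumRing R := by
  intro d x hx i a ha r hr
  have := hsn.isReduced
  obtain rfl : d = 2 := by
    have := hx.1.symm.trans hdim
    exact_mod_cast this
  have hreg := hx.mem_nonZeroDivisors hequi
  rcases Fin.exists_fin_two.1 ⟨i, rfl⟩ with rfl | rfl
  · have h0 : x '' Set.Iio (0 : Fin 2) = ∅ := by
      simp [show Set.Iio (0 : Fin 2) = ∅ from Set.Iio_bot]
    rw [h0, Ideal.span_empty, Ideal.mem_bot] at ha ⊢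
    rw [(mul_right_mem_nonZeroDivisors_eq_zero_iff (hreg 0)).1 ha, mul_zero]
  · have h1 : x '' Set.Iio (1 : Fin 2) = {x 0} := by
      have : Set.Iio (1 : Fin 2) = {0} := by
        ext j
        fin_cases j <;> simp
      rw [this, Set.image_singleton]
    rw [h1, Ideal.mem_span_singleton'] at ha ⊢
    obtain ⟨c, hc⟩ := ha
    obtain ⟨z, hz⟩ : ∃ z : FractionRing R, z * algebraMap R _ (x 0) = algebraMap R _ a :=
      ⟨IsLocalization.mk' _ a ⟨x 0, hreg 0⟩, IsLocalization.mk'_spec _ _ _⟩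
    have hu (j : Fin 2) : IsUnit (algebraMap R (FractionRing R) (x j)) :=
      IsLocalization.map_units _ (⟨x j, hreg j⟩ : R⁰)
    have hz' : z * algebraMap R _ (x 1) = algebraMap R _ c := by
      rw [← (hu 0).mul_left_inj, mul_right_comm, hz, ← map_mul, ← map_mul, hc]
    have hcar : IsCarriedByPow (maximalIdeal R) z := by
      obtain ⟨n, hn⟩ := Ideal.exists_pow_le_of_le_radical_of_fg hx.2.ge (IsNoetherian.noetherian _)
      refine ⟨n, fun s hs => ?_⟩
      have hs := hn hs
      have : Ideal.span (Set.range x) ≤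
          (LinearMap.range (Algebra.linearMap R (FractionRing R))).comap
            (LinearMap.toSpanSingleton R _ z) := by
        rw [Ideal.span_le]
        rintro _ ⟨j, rfl⟩
        have : ∃ y, algebraMap R (FractionRing R) y = algebraMap R _ (x j) * z := by
          fin_cases j
          · exact ⟨a, by rw [← hz, mul_comm]; rfl⟩
          · exact ⟨c, by rw [← hz', mul_comm]; rfl⟩
        simpa [Algebra.smul_def] using this
      simpa [Algebra.smul_def, eq_comm] using this hs
    obtain ⟨s, hs⟩ := hsn.mul_mem_range_of_isIntegral hdim hR1
      (isIntegral_of_isCarriedByPow hdim hequi hcar) hr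
    refine ⟨s, IsFractionRing.injective R (FractionRing R) ?_⟩
    rw [map_mul, map_mul, hs, ← hz, mul_assoc]

end

open CategoryTheory Opposite

namespace CategoryTheory.ProjectiveResolution

section

variable {A : Type*} [Category* A] [Abelian A] {R : Type*} [Ring R] [Linear R A]
  [EnoughProjectives A]

/-- The map of `Hom`-complexes induced by a map of chain complexes. -/
noncomputable def linearYonedaObjMap (R : Type*) [Ring R] [Linear R A] {K L : ChainComplex A ℕ}
    (φ : K ⟶ L) (Y : A) : L.linearYonedaObj R Y ⟶ K.linearYonedaObj R Y :=
  (HomologicalComplex.unopFunctor _ _).map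
    ((((linearYoneda R A).obj Y).rightOp.mapHomologicalComplex _).map φ).op

theorem isoExt_hom_naturality {X X' : A} (f : X ⟶ X') (P : ProjectiveResolution X)
    (Q : ProjectiveResolution X') (φ : P.complex ⟶ Q.complex)
    (comm : φ.f 0 ≫ Q.π.f 0 = P.π.f 0 ≫ f) (n : ℕ) (Y : A) :
    (((Ext R A n).map f.op).app Y) ≫ (P.isoExt n Y).hom =
      (Q.isoExt n Y).hom ≫ HomologicalComplex.homologyMap (linearYonedaObjMap R φ Y) n := by
  have h1 := congrArg Quiver.Hom.unop
    (P.isoLeftDerivedObj_inv_naturality f Q φ comm ((linearYoneda R A).obj Y).rightOp n)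
  have h2 := congrArg Quiver.Hom.unop (ShortComplex.homologyOpIso_inv_naturality
    ((HomologicalComplex.shortComplexFunctor _ _ n).map (linearYonedaObjMap R φ Y)))
  exact ((Category.assoc _ _ _).symm.trans (congrArg
    (· ≫ ((P.complex.linearYonedaObj R Y).homologyOp n).inv.unop) h1)).trans
    ((Category.assoc _ _ _).trans ((congrArg ((Q.isoLeftDerivedObj
      ((linearYoneda R A).obj Y).rightOp n).inv.unop ≫ ·) h2.symm).trans
      (Category.assoc _ _ _).symm))

variable {X : A} (P : ProjectiveResolution X) {Y : A}

/-- The cocycle `w` on the projective resolution `P` represents the class `e`. -/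
def Represents (w : P.complex.X 1 ⟶ Y) (e : ((Ext R A 1).obj (op X)).obj Y) : Prop :=
  ∃ z : (P.complex.linearYonedaObj R Y).cycles 1,
    (P.complex.linearYonedaObj R Y).iCycles 1 z = w ∧
      (P.complex.linearYonedaObj R Y).homologyπ 1 z = (P.isoExt 1 Y).hom e

theorem exists_represents (e : ((Ext R A 1).obj (op X)).obj Y) :
    ∃ w : P.complex.X 1 ⟶ Y, P.Represents w e := by
  obtain ⟨z, hz⟩ := (ModuleCat.epi_iff_surjective _).1
    (inferInstance : Epi ((P.complex.linearYonedaObj R Y).homologyπ 1)) ((P.isoExt 1 Y).hom e)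
  exact ⟨_, z, rfl, hz⟩

variable {P}

theorem Represents.d_comp {w : P.complex.X 1 ⟶ Y} {e : ((Ext R A 1).obj (op X)).obj Y}
    (h : P.Represents w e) : P.complex.d 2 1 ≫ w = 0 := by
  obtain ⟨z, rfl, -⟩ := h
  exact ConcreteCategory.congr_hom ((P.complex.linearYonedaObj R Y).iCycles_d 1 2) z

variable (R) in
theorem exists_represents_of_d_comp {w : P.complex.X 1 ⟶ Y} (hw : P.complex.d 2 1 ≫ w = 0) :
    ∃ e : ((Ext R A 1).obj (op X)).obj Y, P.Represents w e := by
  have hex := ShortComplex.exact_of_f_is_kernel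
    (ShortComplex.mk _ _ ((P.complex.linearYonedaObj R Y).iCycles_d 1 2))
    ((P.complex.linearYonedaObj R Y).cyclesIsKernel 1 2 (by simp))
  obtain ⟨z, hz⟩ := (ShortComplex.moduleCat_exact_iff _).1 hex w hw
  refine ⟨(P.isoExt 1 Y).inv ((P.complex.linearYonedaObj R Y).homologyπ 1 z), z, hz, ?_⟩
  exact (ConcreteCategory.congr_hom (P.isoExt 1 Y).inv_hom_id _).symm

theorem Represents.exists_d_comp_eq {w : P.complex.X 1 ⟶ Y}
    (h : P.Represents w (0 : ((Ext R A 1).obj (op X)).obj Y)) :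
    ∃ v : P.complex.X 0 ⟶ Y, P.complex.d 1 0 ≫ v = w := by
  obtain ⟨z, rfl, hz⟩ := h
  rw [map_zero] at hz
  have hex := ShortComplex.exact_of_g_is_cokernel
    (ShortComplex.mk _ _ ((P.complex.linearYonedaObj R Y).toCycles_comp_homologyπ 0 1))
    ((P.complex.linearYonedaObj R Y).homologyIsCokernel 0 1 (by simp))
  obtain ⟨v, rfl⟩ := (ShortComplex.moduleCat_exact_iff _).1 hex z hz
  exact ⟨v, (ConcreteCategory.congr_hom ((P.complex.linearYonedaObj R Y).toCycles_i 0 1) v).symm⟩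

theorem Represents.eq_zero {v : P.complex.X 0 ⟶ Y} {e : ((Ext R A 1).obj (op X)).obj Y}
    (h : P.Represents (P.complex.d 1 0 ≫ v) e) : e = 0 := by
  obtain ⟨z, hz, he⟩ := h
  have hz' : (P.complex.linearYonedaObj R Y).toCycles 0 1 v = z := by
    apply (ModuleCat.mono_iff_injective _).1
      (inferInstance : Mono ((P.complex.linearYonedaObj R Y).iCycles 1))
    rw [hz]
    exact ConcreteCategory.congr_hom ((P.complex.linearYonedaObj R Y).toCycles_i 0 1) v
  have h0 : (P.isoExt 1 Y).hom e = 0 := by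
    rw [← he, ← hz']
    exact ConcreteCategory.congr_hom
      ((P.complex.linearYonedaObj R Y).toCycles_comp_homologyπ 0 1) v
  exact (ConcreteCategory.congr_hom (P.isoExt 1 Y).hom_inv_id e).symm.trans
    ((congrArg (P.isoExt 1 Y).inv h0).trans (map_zero _))

theorem Represents.smul {R : Type*} [CommRing R] [Linear R A] {w : P.complex.X 1 ⟶ Y}
    {e : ((Ext R A 1).obj (op X)).obj Y} (h : P.Represents w e) (r : R) :
    P.Represents (r • w) (r • e) := by
  obtain ⟨z, rfl, hz⟩ := h
  exact ⟨r • z, map_smul _ _ _, by rw [map_smul, map_smul, hz]⟩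

theorem Represents.map {X' : A} {Q : ProjectiveResolution X'} {f : X ⟶ X'}
    {φ : P.complex ⟶ Q.complex} (comm : φ.f 0 ≫ Q.π.f 0 = P.π.f 0 ≫ f) {w : Q.complex.X 1 ⟶ Y}
    {e : ((Ext R A 1).obj (op X')).obj Y} (h : Q.Represents w e) :
    P.Represents (φ.f 1 ≫ w) (((Ext R A 1).map f.op).app Y e) := by
  obtain ⟨z, rfl, hz⟩ := h
  refine ⟨HomologicalComplex.cyclesMap (linearYonedaObjMap R φ Y) 1 z, ?_, ?_⟩
  · exact ConcreteCategory.congr_hom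
      (HomologicalComplex.cyclesMap_i (linearYonedaObjMap R φ Y) 1) z
  · refine (ConcreteCategory.congr_hom
      (HomologicalComplex.homologyπ_naturality (linearYonedaObjMap R φ Y) 1) z).symm.trans ?_
    refine (congrArg (HomologicalComplex.homologyMap (linearYonedaObjMap R φ Y) 1) hz).trans ?_
    exact (ConcreteCategory.congr_hom (isoExt_hom_naturality f P Q φ comm 1 Y) e).symm

end
end CategoryTheory.ProjectiveResolution

namespace CategoryTheory.ProjectiveResolution

universe u

variable {R : Type u} [CommRing R] {X : ModuleCat.{u} R}

theorem exists_π_apply_eq (P : ProjectiveResolution X) (y : X) :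
    ∃ q : P.complex.X 0, (P.π.f 0) q = y :=
  (ModuleCat.epi_iff_surjective _).1 (inferInstance : Epi (P.π.f 0)) y

theorem exists_d_apply_eq (P : ProjectiveResolution X) {q : P.complex.X 0}
    (hq : (P.π.f 0) q = 0) : ∃ p : P.complex.X 1, P.complex.d 1 0 p = q :=
  (ShortComplex.moduleCat_exact_iff _).1 P.exact₀ q hq

theorem apply_eq_zero_of_d_apply_eq_zero (P : ProjectiveResolution X) {Y : ModuleCat.{u} R}
    {w : P.complex.X 1 ⟶ Y} (hw : P.complex.d 2 1 ≫ w = 0) {p : P.complex.X 1}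
    (hp : P.complex.d 1 0 p = 0) : w p = 0 := by
  obtain ⟨t, rfl⟩ := (ShortComplex.moduleCat_exact_iff _).1 (P.exact_succ 0) p hp
  exact ConcreteCategory.congr_hom hw t

theorem exists_d_apply_eq_smul {I : Ideal R} (P : ProjectiveResolution (ModuleCat.of R (R ⧸ I)))
    {a : R} (ha : a ∈ I) (q : P.complex.X 0) : ∃ p : P.complex.X 1, P.complex.d 1 0 p = a • q := by
  apply P.exists_d_apply_eq
  rw [map_smul]
  obtain ⟨b, hb⟩ := Ideal.Quotient.mk_surjective (I := I) ((P.π.f 0) q : R ⧸ I)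
  have : a • Ideal.Quotient.mk I b = 0 := by
    rw [← Ideal.Quotient.mk_eq_mk, ← Submodule.Quotient.mk_smul, Ideal.Quotient.mk_eq_mk,
      Ideal.Quotient.eq_zero_iff_mem]
    exact I.mul_mem_right _ ha
  rw [hb] at this
  exact this

end CategoryTheory.ProjectiveResolution

section

universe u

variable {R : Type u} [CommRing R] {K : Type*} [CommRing K] [Algebra R K] [IsFractionRing R K]

/-- An element multiplying all fractions `x` with `I x ⊆ R` into `R` kills `Ext¹(R / I, R)`. -/
theorem smul_ext_one_eq_zero {I : Ideal R} {s : R} (hsI : s ∈ I) (hs : s ∈ R⁰) {r : R}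
    (hr : ∀ x : K, (∀ a ∈ I, ∃ b : R, algebraMap R K a * x = algebraMap R K b) →
      ∃ b : R, algebraMap R K r * x = algebraMap R K b)
    (e : ((Ext R (ModuleCat.{u} R) 1).obj (op (ModuleCat.of R (R ⧸ I)))).obj (ModuleCat.of R R)) :
    r • e = 0 := by
  let P := projectiveResolution (ModuleCat.of R (R ⧸ I))
  obtain ⟨w, hw⟩ := P.exists_represents e
  have hinj := IsFractionRing.injective R K
  have hcomp {p p' : P.complex.X 1} {a a' : R} {q : P.complex.X 0}
      (h : P.complex.d 1 0 p = a • q) (h' : P.complex.d 1 0 p' = a' • q) :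
      a' * w p = a * w p' := by
    have := P.apply_eq_zero_of_d_apply_eq_zero hw.d_comp (p := a' • p - a • p') (by
      rw [map_sub, map_smul, map_smul, h, h', smul_comm, sub_self])
    rwa [map_sub, map_smul, map_smul, sub_eq_zero] at this
  have key (q : P.complex.X 0) : ∃ c : R, ∀ p, P.complex.d 1 0 p = s • q → s * c = r * w p := by
    obtain ⟨p, hp⟩ := P.exists_d_apply_eq_smul hsI q
    have hu : algebraMap R K s * IsLocalization.mk' K (w p : R) ⟨s, hs⟩ = algebraMap R K (w p) :=
      IsLocalization.mk'_spec' K (w p : R) ⟨s, hs⟩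
    set x := IsLocalization.mk' K (w p : R) (⟨s, hs⟩ : R⁰)
    have hus : IsUnit (algebraMap R K s) := IsLocalization.map_units K (⟨s, hs⟩ : R⁰)
    obtain ⟨c, hc⟩ := hr x fun a ha => by
      obtain ⟨p', hp'⟩ := P.exists_d_apply_eq_smul ha q
      refine ⟨w p', ?_⟩
      rw [← hus.mul_right_inj, mul_left_comm, hu, ← map_mul, ← map_mul, hcomp hp hp']
    refine ⟨c, fun p₁ hp₁ => hinj ?_⟩
    have : s * w p = s * w p₁ := hcomp hp hp₁
    have := (mul_cancel_left_mem_nonZeroDivisors hs).1 this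
    rw [map_mul, ← hc, mul_left_comm, hu, ← map_mul, this]
  choose c hc using key
  have hcancel {a b : R} (h : s * a = s * b) : a = b :=
    (mul_cancel_left_mem_nonZeroDivisors hs).1 h
  let v : P.complex.X 0 →ₗ[R] R :=
    { toFun := c
      map_add' := fun q q' => hcancel (by
        obtain ⟨p, hp⟩ := P.exists_d_apply_eq_smul hsI q
        obtain ⟨p', hp'⟩ := P.exists_d_apply_eq_smul hsI q'
        rw [hc _ (p + p') (by rw [map_add, hp, hp', smul_add]), mul_add, hc _ p hp, hc _ p' hp',
          map_add, mul_add])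
      map_smul' := fun a q => hcancel (by
        obtain ⟨p, hp⟩ := P.exists_d_apply_eq_smul hsI q
        rw [hc _ (a • p) (by rw [map_smul, hp, smul_comm]), map_smul, smul_eq_mul, smul_eq_mul,
          RingHom.id_apply, mul_left_comm s, hc _ p hp, mul_left_comm]) }
  refine CategoryTheory.ProjectiveResolution.Represents.eq_zero (P := P) (v := ModuleCat.ofHom v) ?_
  have : P.complex.d 1 0 ≫ ModuleCat.ofHom v = r • w := by
    ext p
    change c (P.complex.d 1 0 p) = r * w p
    apply hcancel
    rw [hc _ (s • p) (by rw [map_smul]), map_smul, smul_eq_mul, mul_left_comm]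
  rw [this]
  exact hw.smul r

/-- A fraction `x` with `I x ⊆ R` gives a class in `Ext¹(R / I, R)`, and an element killing its
image in `Ext¹(R / J, R)` multiplies `x` into `R`. -/
theorem exists_ext_one_forall_smul_eq_zero {I : Ideal R} {x : K}
    (hx : ∀ a ∈ I, ∃ b : R, algebraMap R K a * x = algebraMap R K b) :
    ∃ e : ((Ext R (ModuleCat.{u} R) 1).obj (op (ModuleCat.of R (R ⧸ I)))).obj (ModuleCat.of R R),
      ∀ (J : Ideal R) (s : R), s ∈ J → s ∈ R⁰ →
        ∀ f : ModuleCat.of R (R ⧸ J) ⟶ ModuleCat.of R (R ⧸ I),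
          f (Ideal.Quotient.mk J 1) = Ideal.Quotient.mk I 1 →
        ∀ r : R, ((Ext R (ModuleCat.{u} R) 1).map f.op).app (ModuleCat.of R R) (r • e) = 0 →
          ∃ b : R, algebraMap R K r * x = algebraMap R K b := by
  let Q := projectiveResolution (ModuleCat.of R (R ⧸ I))
  have hinj := IsFractionRing.injective R K
  obtain ⟨g, hg⟩ : ∃ g : Q.complex.X 0 ⟶ ModuleCat.of R R,
      g ≫ ModuleCat.ofHom (Submodule.mkQ I) = Q.π.f 0 := by
    have : Epi (ModuleCat.ofHom (Submodule.mkQ I)) :=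
      (ModuleCat.epi_iff_surjective _).2 (Submodule.mkQ_surjective I)
    let π₀ : Q.complex.X 0 ⟶ ModuleCat.of R (R ⧸ I) := Q.π.f 0
    exact Projective.factors π₀ (ModuleCat.ofHom (Submodule.mkQ I))
  have hg' (q : Q.complex.X 0) : Ideal.Quotient.mk I (g q) = (Q.π.f 0) q :=
    ConcreteCategory.congr_hom hg q
  have hgd (q : Q.complex.X 1) : (g (Q.complex.d 1 0 q) : R) ∈ I := by
    rw [← Ideal.Quotient.eq_zero_iff_mem, hg']
    exact ConcreteCategory.congr_hom Q.complex_d_comp_π_f_zero q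
  choose b hb using fun q : Q.complex.X 1 => hx _ (hgd q)
  let w : Q.complex.X 1 →ₗ[R] R :=
    { toFun := b
      map_add' := fun q q' => hinj (by
        rw [map_add, ← hb, ← hb, ← hb, map_add, map_add, map_add, add_mul])
      map_smul' := fun a q => hinj (by
        rw [smul_eq_mul, map_mul, ← hb, ← hb, map_smul, map_smul, smul_eq_mul, map_mul, mul_assoc]
        rfl) }
  obtain ⟨e, he⟩ := CategoryTheory.ProjectiveResolution.exists_represents_of_d_comp R (P := Q)
    (w := ModuleCat.ofHom w) (by
      ext q
      change b (Q.complex.d 2 1 q) = 0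
      apply hinj
      have : Q.complex.d 1 0 (Q.complex.d 2 1 q) = 0 :=
        ConcreteCategory.congr_hom (Q.complex.d_comp_d 2 1 0) q
      rw [← hb, this, map_zero, map_zero, zero_mul])
  refine ⟨e, fun J s hsJ hs f hf r hr => ?_⟩
  let P := projectiveResolution (ModuleCat.of R (R ⧸ J))
  let φ := ProjectiveResolution.lift f P Q
  have comm : φ.f 0 ≫ Q.π.f 0 = P.π.f 0 ≫ f := by
    have := ProjectiveResolution.lift_commutes_zero f P Q
    exact this
  have h1 := (he.smul r).map comm
  rw [hr] at h1
  obtain ⟨v, hv⟩ := h1.exists_d_comp_eq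
  obtain ⟨p, hp⟩ := P.exists_π_apply_eq (Ideal.Quotient.mk J 1 : R ⧸ J)
  obtain ⟨p₁, hp₁⟩ := P.exists_d_apply_eq_smul hsJ p
  have hv1 : (v (s • p) : R) = r * b (φ.f 1 p₁) := by
    rw [← hp₁]
    exact ConcreteCategory.congr_hom hv p₁
  have hφ : Q.complex.d 1 0 (φ.f 1 p₁) = s • φ.f 0 p := by
    rw [← map_smul, ← hp₁]
    exact ConcreteCategory.congr_hom (φ.comm 1 0) p₁
  have hgp : Ideal.Quotient.mk I (g (φ.f 0 p)) = Ideal.Quotient.mk I 1 := by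
    rw [hg', ← hf, ← hp]
    exact ConcreteCategory.congr_hom comm p
  obtain ⟨c, hc⟩ := hx _ (Ideal.Quotient.eq.1 hgp)
  have hus : IsUnit (algebraMap R K s) := IsLocalization.map_units K (⟨s, hs⟩ : R⁰)
  refine ⟨(v p : R) - r * c, ?_⟩
  rw [← hus.mul_right_inj, map_sub, map_mul, ← hc, mul_sub, ← map_mul, ← smul_eq_mul s (v p : R),
    ← map_smul, hv1, map_mul, ← hb, hφ, map_smul, smul_eq_mul, map_mul, map_sub, map_one]
  ring

theorem mem_annihilator_localCohomology_one_iff {m : Ideal R} {s : R} (hsm : s ∈ m) (hs : s ∈ R⁰)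
    {r : R} :
    r ∈ Module.annihilator R ((localCohomology m 1).obj (ModuleCat.of R R)) ↔
      ∀ x : K, IsCarriedByPow m x → ∃ b : R, algebraMap R K r * x = algebraMap R K b := by
  let F := localCohomology.diagram (localCohomology.idealPowersDiagram m) 1
  let c := ((evaluation _ _).obj (ModuleCat.of R R)).mapCocone (Limits.colimit.cocone F)
  have hc : Limits.IsColimit c :=
    Limits.isColimitOfPreserves ((evaluation _ _).obj (ModuleCat.of R R))
      (Limits.colimit.isColimit F)
  have : Limits.PreservesFilteredColimitsOfSize.{0, 0} (forget (ModuleCat.{u} R)) :=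
    Limits.preservesFilteredColimitsOfSize_shrink.{0, u, 0, u} _
  rw [Module.mem_annihilator]
  constructor
  · rintro h x ⟨n, hx⟩
    obtain ⟨e, he⟩ := exists_ext_one_forall_smul_eq_zero hx
    have h0 : c.ι.app (op (op n)) (r • e) = c.ι.app (op (op n)) 0 := by
      exact (map_smul (c.ι.app (op (op n))).hom r e).trans ((h _).trans (map_zero _).symm)
    obtain ⟨j, f, f', hff⟩ := (Limits.Concrete.isColimit_rep_eq_iff_exists _ hc _ _).1 h0
    rw [map_zero] at hff
    exact he (m ^ j.unop.unop) (s ^ j.unop.unop) (Ideal.pow_mem_pow hsm _) (pow_mem hs _)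
      ((localCohomology.ringModIdeals (localCohomology.idealPowersDiagram m)).map f.unop) rfl r hff
  · intro h y
    obtain ⟨j, e, rfl⟩ := Limits.Concrete.isColimit_exists_rep _ hc y
    have : r • e = 0 := smul_ext_one_eq_zero (K := K) (I := m ^ j.unop.unop)
      (Ideal.pow_mem_pow hsm j.unop.unop) (pow_mem hs j.unop.unop)
      (fun x hx => h x ⟨_, hx⟩) e
    exact (map_smul (c.ι.app j).hom r e).symm.trans ((congrArg (c.ι.app j) this).trans (map_zero _))

end

theorem mainTheorem8 (R : Type*) [CommRing R] [IsLocalRing R] [IsNoetherianRing R]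
    [IsAdicComplete (IsLocalRing.maximalIdeal R) R]
    (hdim : ringKrullDim R = 2) (hequi : IsEquidimensionalRing R)
    (hsn : IsSeminormalRing R) (hR1 : SatisfiesSerreR R 1) :
    IsBuchsbaumRing R ∧
    conductorIdeal R = Module.annihilator R
      ((localCohomology (IsLocalRing.maximalIdeal R) 1).obj (ModuleCat.of R R)) ∧
    (¬ IsIntegrallyClosedIn R (FractionRing R) →
      conductorIdeal R = IsLocalRing.maximalIdeal R) := by
  have := hsn.isReduced
  refine ⟨hsn.isBuchsbaumRing hdim hequi hR1, ?_, hsn.conductorIdeal_eq_maximalIdeal hdim hR1⟩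
  obtain ⟨s, hsm, hs⟩ := exists_mem_maximalIdeal_mem_nonZeroDivisors hdim hequi
  ext r
  rw [mem_conductorIdeal_iff,
    mem_annihilator_localCohomology_one_iff (K := FractionRing R) hsm hs]
  refine forall_congr' fun x => ?_
  rw [show IsIntegral R x ↔ IsCarriedByPow (maximalIdeal R) x from
    ⟨fun h => h.isCarriedByPow hdim hR1, isIntegral_of_isCarriedByPow hdim hequi⟩]
  exact imp_congr_right fun _ => exists_congr fun _ => eq_comm
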